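/- \textbf{Setting.} Let $k\ge 2$ be an integer, $L\ge 1$, and let $d_0,\dots,d_{2L}$ be layer widths with $d_{2L}=1$; put $n=d_0$. Let $\mathcal X\subset\mathbb R^n$ be open. For each $l\in\{1,\dots,L\}$ and $1\le i\le d_{2l-1}$ fix an activation function $[\sigma_l]_i\in C^k(\mathbb R,\mathbb R)$ whose derivative is everywhere positive or everywhere negative, and let $\sigma_l$ act component-wise on $\mathbb R^{d_{2l-1}}$. For weights $W=(V_1,\dots,V_{2L})=(W_1,\widetilde W_1,\dots,W_L,\widetilde W_L)$, $V_j\in\mathbb R^{d_j\times d_{j-1}}$, and biases $b=(b_1,\tilde b_1,\dots,b_L,\tilde b_L)\in\mathbb R^{d_1}\times\cdots\times\mathbb R^{d_{2L}}$, the multilayer perceptron $\Phi=\Phi_{W,b}:\mathcal X\to\mathbb R$ is $\Phi(x)=h_L$, where $h_0=x$, $a_l=W_lh_{l-1}+b_l$ and $h_l=\widetilde W_l\sigma_l(a_l)+\tilde b_l$. The layers are enumerated as $g_{2l}=h_l$, $g_{2l-1}=a_l$, so that $g_j\in\mathbb R^{d_j}$. Let $\mathbb W$ be the space of all weights, $\mathbb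 B$ the space of all biases, and $\mathbb W^*\subset\mathbb W$ the set of $W$ all of whose matrices have full rank, $\operatorname{rank}V_j=\min\{d_j,d_{j-1}\}$. ``Almost all weights and biases'' means: all $(W,b)\in\mathbb W\times\mathbb B\cong\mathbb R^{N_W+N_B}$ outside a Lebesgue null set, where $N_W+N_B$ is the total number of weight and bias entries. With $\Psi_l(a_l)=\operatorname{diag}([\sigma_l]_i'([a_l]_i))$ put, for $1\le l\le 2L-1$, $$Z_l(x)=Z_l(x;W,b)=\widetilde W_L\Psi_L(a_L)W_L\cdots V_{l+1}\in\mathbb R^{1\times d_l},$$ the product of the factors of $\nabla\Phi(x)^\top=\widetilde W_L\Psi_L(a_L)W_L\cdots\widetilde W_1\Psi_1(a_1)W_1$ from the left up to and including $V_{l+1}$. A function $\Phi\in C^k(\mathcal X,\mathbb R)$ is of class $(\mathcal C1)^k$ if it has no critical point in $\mathcal X$; of class $(\mathcal C2)^k$ if it has at least one critical point and all its critical points are non-degenerate (non-singular Hessian); of class $(\mathcal C3)^k$ if it has at least one degenerate critical point. The network has a bottleneck in layer $g_j$ if there are $0\le i<j<l\le 2L$ with $d_i>d_j<d_l$. Assume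 that there is a bottleneck and that the first one is in layer $g_{j^*}$. It is called non-augmented if $n=d_0\ge d_1\ge\cdots\ge d_{j^*-1}>d_{j^*}$, and augmented, with index $i^*$, if $0<i^*<j^*$ and $n=d_0\le d_1\le\cdots\le d_{i^*-1}<d_{i^*}$. \textbf{Theorem.} (a) Let the first bottleneck be non-augmented. If $W\in\mathbb W^*$, $b\in\mathbb B$ and $Z_{j^*}(x)\ne0$ for all $x\in\mathcal X$, then $\Phi$ is of class $(\mathcal C1)^k$. Consequently, for almost all $(W,b)\in\mathbb W\times\mathbb B$: if $Z_{j^*}(x)\neq 0$ for all $x\in\mathcal X$, then $\Phi$ is of class $(\mathcal C1)^k$. (b) Let the first bottleneck be non-augmented, let $W\in\mathbb W$, $b\in\mathbb B$, and suppose that $\mathcal X^*=\{x\in\mathcal X: Z_{j^*}(x)=0\}$ is non-empty. Then every $x^*\in\mathcal X^*$ is a degenerate critical point of $\Phi$; in particular $\Phi$ is of class $(\mathcal C3)^k$. (c) Let the first bottleneck be augmented with index $i^*$. For almost all $(W,b)$ with $W\in\mathbb W^*$, $b\in\mathbb B$: if $Z_{i^*}(x)\ne 0$ for all $x\in\mathcal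 X$, then $\Phi$ is of class $(\mathcal C1)^k$ or $(\mathcal C2)^k$. The same holds with $\mathbb W^*$ replaced by $\mathbb W$. (d) Let the first bottleneck be augmented with index $i^*$, let $W\in\mathbb W$, $b\in\mathbb B$, and suppose that $\mathcal X^*=\{x\in\mathcal X: Z_{i^*}(x)=0\}$ is non-empty. Then every $x^*\in\mathcal X^*$ is a critical point of $\Phi$, and $\Phi$ is of class $(\mathcal C2)^k$ or $(\mathcal C3)^k$. Both possibilities occur: for every $k\ge2$ there are an architecture with all widths positive and augmented first bottleneck, activation functions as above, an open set $\mathcal X$, and two choices of $(W,b)$ with $W\in\mathbb W^*$, such that for the first choice some $x^*\in\mathcal X^*$ is degenerate and $\Phi$ is of class $(\mathcal C3)^k$, and for the second choice some $x^*\in\mathcal X^*$ is non-degenerate and $\Phi$ is of class $(\mathcal C2)^k$. -/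

import Mathlib

open MeasureTheory

noncomputable section

/-! ### Classes of scalar functions -/

/-- The Hessian matrix of `Φ : ℝⁿ → ℝ` at `x`, i.e. the matrix of second partial derivatives. -/
def hessian {n : ℕ} (Φ : EuclideanSpace ℝ (Fin n) → ℝ) (x : EuclideanSpace ℝ (Fin n)) :
    Matrix (Fin n) (Fin n) ℝ :=
  Matrix.of fun i j =>
    fderiv ℝ (fderiv ℝ Φ) x (EuclideanSpace.single i 1) (EuclideanSpace.single j 1)

/-- `x` is a critical point of `Φ`. -/
def IsCritical {n : ℕ} (Φ : EuclideanSpace ℝ (Fin n) → ℝ) (x : EuclideanSpace ℝ (Fin n)) : Prop :=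
  gradient Φ x = 0

/-- `x` is a critical point of `Φ` with singular Hessian matrix. -/
def IsDegenerateCritical {n : ℕ} (Φ : EuclideanSpace ℝ (Fin n) → ℝ)
    (x : EuclideanSpace ℝ (Fin n)) : Prop :=
  IsCritical Φ x ∧ (hessian Φ x).det = 0

/-- `x` is a critical point of `Φ` with non-singular Hessian matrix. -/
def IsNondegenerateCritical {n : ℕ} (Φ : EuclideanSpace ℝ (Fin n) → ℝ)
    (x : EuclideanSpace ℝ (Fin n)) : Prop :=
  IsCritical Φ x ∧ (hessian Φ x).det ≠ 0

/-- `(C1)ᵏ(X, ℝ)`: `Cᵏ` functions on the open set `X` without critical points. -/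
def ClassC1 {n : ℕ} (k : ℕ) (X : Set (EuclideanSpace ℝ (Fin n)))
    (Φ : EuclideanSpace ℝ (Fin n) → ℝ) : Prop :=
  ContDiffOn ℝ k Φ X ∧ ∀ x ∈ X, ¬ IsCritical Φ x

/-- `(C2)ᵏ(X, ℝ)`: `Cᵏ` functions on the open set `X` with at least one critical point, all of
whose critical points are non-degenerate. -/
def ClassC2 {n : ℕ} (k : ℕ) (X : Set (EuclideanSpace ℝ (Fin n)))
    (Φ : EuclideanSpace ℝ (Fin n) → ℝ) : Prop :=
  ContDiffOn ℝ k Φ X ∧ (∃ p ∈ X, IsCritical Φ p) ∧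
    ∀ q ∈ X, IsCritical Φ q → IsNondegenerateCritical Φ q

/-- `(C3)ᵏ(X, ℝ)`: `Cᵏ` functions on the open set `X` with at least one degenerate critical
point. -/
def ClassC3 {n : ℕ} (k : ℕ) (X : Set (EuclideanSpace ℝ (Fin n)))
    (Φ : EuclideanSpace ℝ (Fin n) → ℝ) : Prop :=
  ContDiffOn ℝ k Φ X ∧ ∃ p ∈ X, IsDegenerateCritical Φ p

/-! ### Multilayer perceptrons -/

/-- The layer structure of a multilayer perceptron with scalar output: `L ≥ 1` updates, and layers
`g_0, …, g_{2L}`, where `g_{2l} = h_l` are the main layers and `g_{2l-1} = a_l` the pre-activations.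
The width of `g_j` is `d j` (values `d j` with `j > 2L` play no role); the input dimension is
`n = d 0`. -/
structure Architecture where
  L : ℕ
  d : ℕ → ℕ
  one_le_L : 1 ≤ L
  output_width : d (2 * L) = 1

namespace Architecture

variable (A : Architecture)

/-- The input space `ℝⁿ`, `n = d 0`. -/
abbrev Input : Type := EuclideanSpace ℝ (Fin (A.d 0))

/-- Component-wise activation functions: `σ j i` is applied to the `i`-th entry of the layer `g_j`;
only the values at odd `j < 2L` are used. With `j = 2l-1` this is `[σ_l]_i`. -/
abbrev Activation : Type := (j : ℕ) → Fin (A.d j) → ℝ → ℝ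

/-- The activation functions are of class `Cᵏ` and strictly monotone, in the sense that the
derivative is everywhere positive or everywhere negative (used for `k ≥ 1` only). -/
def Admissible (k : ℕ) (σ : A.Activation) : Prop :=
  ∀ j < 2 * A.L, Odd j → ∀ i : Fin (A.d j),
    ContDiff ℝ k (σ j i) ∧ ((∀ t, 0 < deriv (σ j i) t) ∨ (∀ t, deriv (σ j i) t < 0))

/-- The weight space: the entry at `j : Fin (2L)` is the matrix `V_{j+1} ∈ ℝ^{d_{j+1} × d_j}`, where
`(V_1, …, V_{2L}) = (W_1, W̃_1, …, W_L, W̃_L)`. -/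
abbrev Weights : Type :=
  (j : Fin (2 * A.L)) → Matrix (Fin (A.d (j + 1))) (Fin (A.d j)) ℝ

/-- The bias space: the entry at `j : Fin (2L)` is the bias in `ℝ^{d_{j+1}}` of the layer
`g_{j+1}`. -/
abbrev Biases : Type := (j : Fin (2 * A.L)) → Fin (A.d (j + 1)) → ℝ

/-- The index set of all `N_W + N_B` entries of the weight matrices and of the biases. -/
abbrev ParamIndex : Type :=
  ((j : Fin (2 * A.L)) × (Fin (A.d (j + 1)) × Fin (A.d j))) ⊕
    ((j : Fin (2 * A.L)) × Fin (A.d (j + 1)))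

/-- The parameter space `ℝ^{N_W + N_B}` of stacked weights and biases, with its Lebesgue measure
`volume`. -/
abbrev Params : Type := A.ParamIndex → ℝ

/-- The set of weights all of whose matrices have full rank. -/
def fullRank : Set A.Weights :=
  {W | ∀ j : Fin (2 * A.L), (W j).rank = min (A.d (j + 1)) (A.d j)}

variable {A}

/-- The weight matrices that are stacked in `θ`. -/
def Params.weights (θ : A.Params) : A.Weights :=
  fun j => Matrix.of fun r c => θ (Sum.inl ⟨j, r, c⟩)

/-- The biases that are stacked in `θ`. -/
def Params.biases (θ : A.Params) : A.Biases :=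
  fun j r => θ (Sum.inr ⟨j, r⟩)

/-- Applies the activation function to a vector in layer `j` if `j` is odd, and is the identity on
the main layers (`j` even). -/
def activate (σ : A.Activation) (j : ℕ) (v : Fin (A.d j) → ℝ) : Fin (A.d j) → ℝ :=
  fun i => if Odd j then σ j i (v i) else v i

/-- The layers `g_j`: `g_0 = x`, `g_{2l+1} = V_{2l+1} g_{2l} + b`, and
`g_{2l+2} = V_{2l+2} σ(g_{2l+1}) + b`. -/
def layer (σ : A.Activation) (W : A.Weights) (b : A.Biases) (x : A.Input) :
    (j : ℕ) → Fin (A.d j) → ℝ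
  | 0 => fun i => x i
  | j + 1 =>
    if h : j < 2 * A.L then
      (W ⟨j, h⟩).mulVec (activate σ j (layer σ W b x j)) + b ⟨j, h⟩
    else 0

/-- The update rule `h_{l+1} = W̃ σ(W h_l + b) + b̃` in the common enumeration of the layers. -/
theorem layer_update (σ : A.Activation) (W : A.Weights) (b : A.Biases) (x : A.Input)
    (l : ℕ) (h0 : 2 * l < 2 * A.L) (h1 : 2 * l + 1 < 2 * A.L) :
    layer σ W b x (2 * l + 2) =
      (W ⟨2 * l + 1, h1⟩).mulVec
          (fun i => σ (2 * l + 1) i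
            (((W ⟨2 * l, h0⟩).mulVec (layer σ W b x (2 * l))
              + b ⟨2 * l, h0⟩) i))
        + b ⟨2 * l + 1, h1⟩ := by
  have e : activate σ (2 * l) (layer σ W b x (2 * l)) = layer σ W b x (2 * l) := by
    funext i
    simp [activate]
  rw [layer, dif_pos h1, layer, dif_pos h0, e]
  congr 2
  funext i
  simp [activate]

/-- The input-output map `Φ : ℝⁿ → ℝ` of the network. -/
def network (σ : A.Activation) (W : A.Weights) (b : A.Biases) : A.Input → ℝ :=
  fun x => layer σ W b x (2 * A.L) ⟨0, by rw [A.output_width]; exact Nat.one_pos⟩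

/-- The diagonal of `Ψ_l(a_l) = diag([σ_l]_i'([a_l]_i))` if `j = 2l-1` is odd, and the diagonal of
the identity matrix if `j` is even. -/
def psi (σ : A.Activation) (W : A.Weights) (b : A.Biases) (x : A.Input) (j : ℕ) :
    Fin (A.d j) → ℝ :=
  fun i => if Odd j then deriv (σ j i) (layer σ W b x j i) else 1

/-- The row vector `Z_l(x) = W̃_L Ψ_L(a_L) W_L ⋯ V_{l+1} ∈ ℝ^{1 × d_l}`: the product of all matrices
in the network gradient from the output down to and including `V_{l+1}`, with the empty product
`Z_{2L} = 1`. -/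
def Z (σ : A.Activation) (W : A.Weights) (b : A.Biases) (x : A.Input) (l : ℕ) :
    Fin (A.d l) → ℝ :=
  if h : l < 2 * A.L then
    Matrix.vecMul (fun i => Z σ W b x (l + 1) i * psi σ W b x (l + 1) i) (W ⟨l, h⟩)
  else fun _ => 1
termination_by 2 * A.L - l

variable (A)

/-- The network has a bottleneck in layer `g_j`. -/
def HasBottleneckAt (j : ℕ) : Prop :=
  ∃ i l, i < j ∧ j < l ∧ l ≤ 2 * A.L ∧ A.d j < A.d i ∧ A.d j < A.d l

/-- The first bottleneck of the network is in layer `g_j`. -/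
def FirstBottleneckAt (j : ℕ) : Prop :=
  A.HasBottleneckAt j ∧ ∀ j' < j, ¬ A.HasBottleneckAt j'

/-- `d_0 ≥ d_1 ≥ ⋯ ≥ d_{j-1} > d_j`. -/
def DecreasesTo (j : ℕ) : Prop :=
  0 < j ∧ (∀ m, m + 1 < j → A.d (m + 1) ≤ A.d m) ∧ A.d j < A.d (j - 1)

/-- `d_0 ≤ d_1 ≤ ⋯ ≤ d_{i-1} < d_i`. -/
def IncreasesTo (i : ℕ) : Prop :=
  0 < i ∧ (∀ m, m + 1 < i → A.d m ≤ A.d (m + 1)) ∧ A.d (i - 1) < A.d i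

end Architecture

end

/-! The gradient of the network is the row vector `Z_0`, and its Hessian is the derivative of `Z_0`
in the input. Everything rests on cutting `Z_0` at a layer: `Z_0 = (Z_m * ψ_m) J_m`, with `J_m` the
Jacobian of the layer `g_m` (`vecMul_jacobian`). The diagonal factors `ψ_m` never vanish, because
the activations have nonzero derivative.

While the widths decrease, full-rank weights act injectively on row vectors, so a nonzero `Z_j`
forces `Z_0 ≠ 0`: there is no critical point. Where `Z_j` vanishes, the product rule leaves only
`D(Z_j * ψ_j) · J_j`, which factors through `ℝ^{d_j}` with `d_j < d_0`; hence the Hessian is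
singular.

In the augmented case, `Z_i = 0` still gives `Z_0 = 0`. Where `Z_i ≠ 0`, a parametric Sard argument
applies to `F(x, θ) = Z_0`. It needs `F` to be submersive in the parameters: the weight matrix into
the layer `i` is changed while the bias keeps all layers at `x` fixed, so `Z_0` moves along a line.
All directions are reached, since `Z_i ≠ 0` and `J_{i-1}` is injective for full-rank weights and
increasing widths. Hence, for almost all parameters, `D_x Z_0` is onto at these critical points,
that is, they are non-degenerate.

The two possibilities in (d) come from a one-dimensional network computing `a * x + x + sin x / 2`.
-/

noncomputable section

/-! ### Parametric Sard theorem -/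

section ParametricSard

variable {E P G : Type*} [NormedAddCommGroup E] [NormedSpace ℝ E]
  [NormedAddCommGroup P] [NormedSpace ℝ P] [NormedAddCommGroup G] [NormedSpace ℝ G]

/-- If `F (x, Θ (x, q)) = 0` identically and `F` is submersive in the parameter, then `Θ` is
singular wherever `F` fails to be submersive in the variable. -/
theorem not_surjective_of_solution {K : Type*} [NormedAddCommGroup K] [NormedSpace ℝ K]
    {D : E × P →L[ℝ] G} {X' : E × K →L[ℝ] E × P}
    (h0 : D.comp X' = 0) (hfst : ∀ w, (X' w).1 = w.1)
    (hP : Function.Surjective fun v : P => D (0, v))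
    (hE : ¬ Function.Surjective fun v : E => D (v, 0)) :
    ¬ Function.Surjective fun w => (X' w).2 := by
  intro hs
  refine hE fun g => ?_
  obtain ⟨v, hv⟩ := hP g
  obtain ⟨w, hw⟩ := hs v
  have hw : (X' w).2 = v := hw
  have hv : D (0, v) = g := hv
  refine ⟨-w.1, ?_⟩
  have h1 : D (X' w) = 0 := by simpa using congrArg (fun L => L w) h0
  have h2 : X' w = (w.1, 0) + (0, v) := by
    ext1 <;> simp [hfst, hw]
  rw [h2, map_add, hv] at h1
  have : ((-w.1, 0) : E × P) = -(w.1, 0) := by simp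
  simp only [this, map_neg]
  exact neg_eq_of_add_eq_zero_right h1

variable [FiniteDimensional ℝ E] [FiniteDimensional ℝ P] [FiniteDimensional ℝ G]
  [MeasurableSpace P] [BorelSpace P] (μ : Measure P) [μ.IsAddHaarMeasure]

/-- Near `p` the zero set of `F` is a graph over `E × K`, with `K` the kernel of the parameter
derivative at `p`. As `dim E = dim G`, this chart has the dimension of `P`, and the projection to
the parameters is singular exactly at the points of concern by `not_surjective_of_solution`.
Equidimensional Sard needs only differentiability, so `F` of class `C¹` suffices. -/
theorem exists_nhds_measure_singular_parameters_eq_zero {F : E × P → G} (hF : ContDiff ℝ 1 F)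
    (hdim : Module.finrank ℝ E = Module.finrank ℝ G) (p : E × P)
    (hp : Function.Surjective fun v : P => fderiv ℝ F p (0, v)) :
    ∃ U ∈ nhds p, μ (Prod.snd '' {q ∈ U | F q = 0 ∧
      (Function.Surjective fun v : P => fderiv ℝ F q (0, v)) ∧
      ¬ Function.Surjective fun v : E => fderiv ℝ F q (v, 0)}) = 0 := by
  let D : P →L[ℝ] G := (fderiv ℝ F p).comp (ContinuousLinearMap.inr ℝ E P)
  have hD : Function.Surjective D := hp
  let K := D.ker
  obtain ⟨π, hπ⟩ : ∃ π : P →L[ℝ] K, ∀ v : K, π v = v := D.ker.exists_isCompl.elim fun Q hQ =>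
    ⟨(Submodule.projectionOnto _ _ hQ).toContinuousLinearMap,
      fun v => Submodule.projectionOnto_apply_left hQ v⟩
  -- `Ψ` straightens the zero set of `F` to `{0} × (E × K)`; its derivative at `p` is injective
  -- between spaces of equal dimension.
  let Ψ : E × P → G × (E × K) := fun q => (F q, (q.1, π q.2))
  have hΨ : ContDiff ℝ 1 Ψ := hF.prodMk
    (contDiff_fst.prodMk (π.contDiff.comp contDiff_snd))
  let Ψ' (q : E × P) : E × P →L[ℝ] G × (E × K) := (fderiv ℝ F q).prod
    ((ContinuousLinearMap.fst ℝ E P).prod (π.comp (ContinuousLinearMap.snd ℝ E P)))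
  have hΨ' : ∀ q, HasFDerivAt Ψ (Ψ' q) q := fun q =>
    ((hF.differentiable (by norm_num)) q).hasFDerivAt.prodMk
      (hasFDerivAt_fst.prodMk (π.hasFDerivAt.comp q hasFDerivAt_snd))
  have hrank : Module.finrank ℝ G + Module.finrank ℝ K = Module.finrank ℝ P := by
    rw [← LinearMap.finrank_range_add_finrank_ker D.toLinearMap,
      LinearMap.range_eq_top.2 hD, finrank_top]
  have hinj : Function.Injective (Ψ' p) := by
    rw [injective_iff_map_eq_zero]
    rintro ⟨u, v⟩ h
    have h1 : fderiv ℝ F p (u, v) = 0 := congrArg Prod.fst h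
    have h2 : u = 0 := congrArg (fun q => q.2.1) h
    have h3 : π v = 0 := congrArg (fun q => q.2.2) h
    subst h2
    have h4 : v ∈ D.ker := h1
    have := hπ ⟨v, h4⟩
    rw [h3] at this
    have : v = 0 := (congrArg Subtype.val this).symm
    simp [this]
  let e : (E × P) ≃L[ℝ] G × (E × K) :=
    (LinearEquiv.ofInjectiveOfFinrankEq (Ψ' p).toLinearMap hinj (by
      simp only [Module.finrank_prod]; omega)).toContinuousLinearEquiv
  have he : HasFDerivAt Ψ (e : E × P →L[ℝ] G × (E × K)) p := by
    convert hΨ' p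
    ext <;> rfl
  let H := hΨ.contDiffAt.toOpenPartialHomeomorph Ψ he one_ne_zero
  have hHp : p ∈ H.source := hΨ.contDiffAt.mem_toOpenPartialHomeomorph_source he one_ne_zero
  have hHΨ : ∀ q, H q = Ψ q := fun q => rfl
  -- Being `C¹` at a point persists nearby, so the inverse is differentiable on a whole
  -- neighbourhood, not only at `Ψ p`.
  have hev : ∀ᶠ z in nhds (Ψ p), DifferentiableAt ℝ H.symm z := by
    have h1 : ContDiffAt ℝ 1 H.symm (Ψ p) := hΨ.contDiffAt.to_localInverse he one_ne_zero
    filter_upwards [h1.eventually (by simp)] with z hz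
    exact hz.differentiableAt one_ne_zero
  refine ⟨H.source ∩ Ψ ⁻¹' {z | DifferentiableAt ℝ H.symm z},
    Filter.inter_mem (H.open_source.mem_nhds hHp) (hΨ.continuous.continuousAt hev), ?_⟩
  -- Any linear identification serves: it turns the projected chart into a map `P → P`, whose
  -- derivative has a determinant.
  let c : P ≃L[ℝ] E × K := ContinuousLinearEquiv.ofFinrankEq (by
    simp only [Module.finrank_prod]; omega)
  let χ : E × K → E × P := fun w => H.symm (0, w)
  let S : Set (E × P) := {q ∈ H.source ∩ Ψ ⁻¹' {z | DifferentiableAt ℝ H.symm z} | F q = 0 ∧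
      (Function.Surjective fun v : P => fderiv ℝ F q (0, v)) ∧
      ¬ Function.Surjective fun v : E => fderiv ℝ F q (v, 0)}
  let w₀ : E × P → E × K := fun q => (q.1, π q.2)
  have hχ : ∀ q ∈ S, χ (w₀ q) = q := by
    rintro q ⟨⟨hq, -⟩, h0, -⟩
    have := H.left_inv hq
    rw [hHΨ] at this
    simpa only [Ψ, h0] using this
  have key : ∀ q ∈ S, ∃ X' : E × K →L[ℝ] E × P, HasFDerivAt χ X' (w₀ q) ∧
      ¬ Function.Surjective fun w => (X' w).2 := by
    intro q hqS
    obtain ⟨⟨hq, hd⟩, h0, hP, hE⟩ := id hqS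
    have hz : Ψ q = (0, w₀ q) := by simp only [Ψ, h0, w₀]
    have hd : DifferentiableAt ℝ H.symm (Ψ q) := hd
    rw [hz] at hd
    have hin : HasFDerivAt (fun w : E × K => ((0 : G), w))
        (ContinuousLinearMap.inr ℝ G (E × K)) (w₀ q) :=
      (ContinuousLinearMap.inr ℝ G (E × K)).hasFDerivAt
    have hX := hd.hasFDerivAt.comp (w₀ q) hin
    refine ⟨_, hX, ?_⟩
    have htar : ∀ᶠ w in nhds (w₀ q), ((0 : G), w) ∈ H.target := by
      refine hin.continuousAt.eventually (H.open_target.mem_nhds ?_)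
      show ((0 : G), w₀ q) ∈ H.target
      rw [← hz, ← hHΨ]
      exact H.map_source hq
    have hinv : ∀ᶠ w in nhds (w₀ q), Ψ (χ w) = (0, w) := by
      filter_upwards [htar] with w hw
      rw [← hHΨ]
      exact H.right_inv hw
    have hX : HasFDerivAt χ _ (w₀ q) := hX
    -- Both conditions come from differentiating `Ψ (χ w) = (0, w)`, in the `G` component and in the
    -- `E` component.
    refine not_surjective_of_solution (D := fderiv ℝ F q) ?_ ?_ hP hE
    · have hFd : HasFDerivAt F (fderiv ℝ F q) (χ (w₀ q)) := by
        rw [hχ q hqS]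
        exact ((hF.differentiable (by norm_num)) q).hasFDerivAt
      refine (hFd.comp (w₀ q) hX).unique ((hasFDerivAt_const (0 : G) _).congr_of_eventuallyEq ?_)
      filter_upwards [hinv] with w hw
      exact congrArg Prod.fst hw
    · intro w
      have h1 : HasFDerivAt (fun w => (χ w).1) (ContinuousLinearMap.fst ℝ E K) (w₀ q) := by
        refine hasFDerivAt_fst.congr_of_eventuallyEq ?_
        filter_upwards [hinv] with w hw
        exact congrArg (fun z => z.2.1) hw
      exact congrArg (fun L => L w) (hX.fst.unique h1)
  have hsub : Prod.snd '' S ⊆ (fun v => (χ (c v)).2) '' (c ⁻¹' (w₀ '' S)) := by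
    rintro _ ⟨q, hq, rfl⟩
    refine ⟨c.symm (w₀ q), ?_, ?_⟩
    · simp only [Set.mem_preimage, ContinuousLinearEquiv.apply_symm_apply]
      exact ⟨q, hq, rfl⟩
    · simp only [ContinuousLinearEquiv.apply_symm_apply, hχ q hq]
  have key' : ∀ v ∈ c ⁻¹' (w₀ '' S), ∃ L : P →L[ℝ] P,
      HasFDerivAt (fun v => (χ (c v)).2) L v ∧ ¬ Function.Surjective L := by
    rintro v ⟨q, hq, hqv⟩
    obtain ⟨X', hX, hs⟩ := key q hq
    rw [hqv] at hX
    refine ⟨_, (hX.comp v c.hasFDerivAt).snd, fun hsur => hs fun y => ?_⟩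
    obtain ⟨u, hu⟩ := hsur y
    exact ⟨c u, hu⟩
  choose! L hL hLs using key'
  refine measure_mono_null hsub
    (addHaar_image_eq_zero_of_det_fderivWithin_eq_zero μ (f' := L)
      (fun v hv => (hL v hv).hasFDerivWithinAt) fun v hv => ?_)
  by_contra hdet
  refine hLs v hv ?_
  exact ((LinearMap.isUnit_iff_isUnit_det (L v).toLinearMap).2
    (isUnit_iff_ne_zero.2 hdet) |> (Module.End.isUnit_iff _).1).2

/-- For almost every parameter, zero is a regular value of `F (·, θ)` on the set where `F` is
submersive in the parameter. -/
theorem measure_singular_parameters_eq_zero {F : E × P → G} (hF : ContDiff ℝ 1 F)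
    (hdim : Module.finrank ℝ E = Module.finrank ℝ G) :
    μ {θ | ∃ x, F (x, θ) = 0 ∧
      (Function.Surjective fun v : P => fderiv ℝ F (x, θ) (0, v)) ∧
      ¬ Function.Surjective fun v : E => fderiv ℝ F (x, θ) (v, 0)} = 0 := by
  let S : Set (E × P) := {q | F q = 0 ∧
      (Function.Surjective fun v : P => fderiv ℝ F q (0, v)) ∧
      ¬ Function.Surjective fun v : E => fderiv ℝ F q (v, 0)}
  have hloc : ∀ p ∈ S, ∃ U ∈ nhds p, μ (Prod.snd '' {q ∈ U | q ∈ S}) = 0 := fun p hp =>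
    exists_nhds_measure_singular_parameters_eq_zero μ hF hdim p hp.2.1
  choose! U hU hμ using hloc
  -- By the Lindelöf property, countably many of the local null sets suffice.
  obtain ⟨t, htS, htc, ht⟩ := TopologicalSpace.countable_cover_nhdsWithin
    (fun p hp => nhdsWithin_le_nhds (s := S) (hU p hp))
  refine measure_mono_null (t := ⋃ p ∈ t, Prod.snd '' {q ∈ U p | q ∈ S}) ?_
    ((measure_biUnion_null_iff htc).2 fun p hp => hμ p (htS hp))
  rintro θ ⟨x, hx⟩
  have hxS : (x, θ) ∈ S := hx
  obtain ⟨p, hp, hxp⟩ := Set.mem_iUnion₂.1 (ht hxS)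
  exact Set.mem_iUnion₂.2 ⟨p, hp, (x, θ), ⟨hxp, hxS⟩, rfl⟩

end ParametricSard

namespace Architecture

variable {A : Architecture}

/-! ### Derivatives of the layers -/

/-- The parameters that consist of the given weights and biases. -/
def Params.mk (W : A.Weights) (b : A.Biases) : A.Params :=
  Sum.elim (fun p => W p.1 p.2.1 p.2.2) (fun p => b p.1 p.2)

/-- The Jacobian matrix of the layer `g_m` as a function of the input. -/
def jacobian (σ : A.Activation) (W : A.Weights) (b : A.Biases) (x : A.Input) :
    (m : ℕ) → Matrix (Fin (A.d m)) (Fin (A.d 0)) ℝ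
  | 0 => 1
  | m + 1 =>
    if h : m < 2 * A.L then
      W ⟨m, h⟩ * (Matrix.diagonal (psi σ W b x m) * jacobian σ W b x m)
    else 0

theorem layer_succ (σ : A.Activation) (W : A.Weights) (b : A.Biases) (x : A.Input) {m : ℕ}
    (h : m < 2 * A.L) :
    layer σ W b x (m + 1) =
      (W ⟨m, h⟩).mulVec (activate σ m (layer σ W b x m)) + b ⟨m, h⟩ := by
  rw [layer, dif_pos h]

theorem jacobian_succ (σ : A.Activation) (W : A.Weights) (b : A.Biases) (x : A.Input) {m : ℕ}
    (h : m < 2 * A.L) :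
    jacobian σ W b x (m + 1) =
      W ⟨m, h⟩ * (Matrix.diagonal (psi σ W b x m) * jacobian σ W b x m) := by
  rw [jacobian, dif_pos h]

theorem Z_of_lt (σ : A.Activation) (W : A.Weights) (b : A.Biases) (x : A.Input) {l : ℕ}
    (h : l < 2 * A.L) :
    Z σ W b x l = Matrix.vecMul (Z σ W b x (l + 1) * psi σ W b x (l + 1)) (W ⟨l, h⟩) := by
  rw [Z, dif_pos h]
  rfl

theorem Z_output (σ : A.Activation) (W : A.Weights) (b : A.Biases) (x : A.Input) :
    Z σ W b x (2 * A.L) = fun _ => 1 := by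
  rw [Z, dif_neg (lt_irrefl _)]

theorem psi_of_even (σ : A.Activation) (W : A.Weights) (b : A.Biases) (x : A.Input) {m : ℕ}
    (h : Even m) : psi σ W b x m = 1 := by
  funext i
  simp [psi, Nat.not_odd_iff_even.2 h]

/-- The chain rule cut at layer `m`. `Z_m` ends with `V_{m+1}` and `J_m` begins with `V_m`, so `ψ_m`
has to be inserted between them. -/
theorem vecMul_jacobian (σ : A.Activation) (W : A.Weights) (b : A.Biases) (x : A.Input) (m : ℕ)
    (hm : m ≤ 2 * A.L) :
    Matrix.vecMul (Z σ W b x m * psi σ W b x m) (jacobian σ W b x m) = Z σ W b x 0 := by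
  induction m with
  | zero => rw [psi_of_even _ _ _ _ (by simp), mul_one, jacobian, Matrix.vecMul_one]
  | succ m ih =>
    have h : m < 2 * A.L := hm
    rw [jacobian_succ _ _ _ _ h, ← Matrix.vecMul_vecMul, ← Z_of_lt _ _ _ _ h,
      ← Matrix.vecMul_vecMul, ← ih h.le]
    congr 1
    funext i
    simp [Matrix.vecMul_diagonal]

theorem hasDerivAt_activate {σ : A.Activation} {k : ℕ} (hσ : A.Admissible k σ) (hk : 1 ≤ k)
    {m : ℕ} (hm : m < 2 * A.L) {c : ℝ → Fin (A.d m) → ℝ} {c' : Fin (A.d m) → ℝ} {t : ℝ}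
    (hc : HasDerivAt c c' t) :
    HasDerivAt (fun s => activate σ m (c s))
      (fun i => (if Odd m then deriv (σ m i) (c t i) else 1) * c' i) t := by
  rw [hasDerivAt_pi] at hc ⊢
  intro i
  by_cases ho : Odd m
  · simp only [activate, ho, if_true]
    have hd : DifferentiableAt ℝ (σ m i) (c t i) :=
      ((hσ m hm ho i).1.differentiable (by simpa using Nat.one_le_iff_ne_zero.1 hk)) _
    exact hd.hasDerivAt.comp t (hc i)
  · simpa only [activate, ho, if_false, one_mul] using hc i

theorem hasDerivAt_mulVec {p q : Type*} [Fintype p] [Fintype q] (M : Matrix p q ℝ)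
    {c : ℝ → q → ℝ} {c' : q → ℝ} {t : ℝ} (hc : HasDerivAt c c' t) :
    HasDerivAt (fun s => M.mulVec (c s)) (M.mulVec c') t := by
  rw [hasDerivAt_pi] at hc ⊢
  intro i
  simp only [Matrix.mulVec, dotProduct]
  exact HasDerivAt.fun_sum fun j _ => (hc j).const_mul _

theorem hasDerivAt_layer {σ : A.Activation} {k : ℕ} (hσ : A.Admissible k σ) (hk : 1 ≤ k)
    (W : A.Weights) (b : A.Biases) (x v : A.Input) (m : ℕ) (hm : m ≤ 2 * A.L) :
    HasDerivAt (fun t : ℝ => layer σ W b (x + t • v) m)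
      ((jacobian σ W b x m).mulVec v.ofLp) 0 := by
  induction m with
  | zero =>
    rw [hasDerivAt_pi]
    intro i
    simp only [layer, jacobian, Matrix.one_mulVec, PiLp.add_apply, PiLp.smul_apply, smul_eq_mul]
    simpa using ((hasDerivAt_id (0 : ℝ)).mul_const (v i)).const_add (x i)
  | succ m ih =>
    have h : m < 2 * A.L := hm
    simp only [layer_succ _ _ _ _ h]
    rw [jacobian_succ _ _ _ _ h]
    refine ((hasDerivAt_mulVec (W ⟨m, h⟩) (hasDerivAt_activate hσ hk h (ih h.le))).add_const
      (b ⟨m, h⟩)).congr_deriv ?_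
    rw [← Matrix.mulVec_mulVec, ← Matrix.mulVec_mulVec]
    congr 1
    funext i
    simp [Matrix.mulVec_diagonal, psi]

/-! ### Joint smoothness in inputs and parameters -/

theorem contDiff_activate {E : Type*} [NormedAddCommGroup E] [NormedSpace ℝ E]
    {σ : A.Activation} {k : ℕ} (hσ : A.Admissible k σ)
    {m : ℕ} (hm : m < 2 * A.L) {f : E → Fin (A.d m) → ℝ} (hf : ContDiff ℝ k f) :
    ContDiff ℝ k (fun p => activate σ m (f p)) := by
  rw [contDiff_pi] at hf ⊢
  intro i
  by_cases ho : Odd m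
  · simp only [activate, ho, if_true]
    exact (hσ m hm ho i).1.comp (hf i)
  · simpa only [activate, ho, if_false] using hf i

theorem contDiff_weights_apply {n : WithTop ℕ∞} (m : Fin (2 * A.L)) (r : Fin (A.d (m + 1)))
    (c : Fin (A.d m)) :
    ContDiff ℝ n (fun p : A.Input × A.Params => p.2.weights m r c) :=
  (contDiff_apply ℝ ℝ (Sum.inl ⟨m, r, c⟩ : A.ParamIndex)).comp contDiff_snd

theorem contDiff_biases_apply {n : WithTop ℕ∞} (m : Fin (2 * A.L)) (r : Fin (A.d (m + 1))) :
    ContDiff ℝ n (fun p : A.Input × A.Params => p.2.biases m r) :=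
  (contDiff_apply ℝ ℝ (Sum.inr ⟨m, r⟩ : A.ParamIndex)).comp contDiff_snd

theorem contDiff_layer {σ : A.Activation} {k : ℕ} (hσ : A.Admissible k σ) (m : ℕ)
    (hm : m ≤ 2 * A.L) :
    ContDiff ℝ k
      (fun p : A.Input × A.Params => layer σ p.2.weights p.2.biases p.1 m) := by
  induction m with
  | zero =>
    rw [contDiff_pi]
    intro i
    simp only [layer]
    fun_prop
  | succ m ih =>
    have h : m < 2 * A.L := hm
    simp only [layer_succ _ _ _ _ h]
    rw [contDiff_pi]
    intro i
    have ha := contDiff_pi.1 (contDiff_activate hσ h (ih h.le))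
    simp only [Pi.add_apply, Matrix.mulVec, dotProduct]
    exact (ContDiff.sum fun c _ => (contDiff_weights_apply ⟨m, h⟩ i c).mul (ha c)).add
      (contDiff_biases_apply ⟨m, h⟩ i)

theorem contDiff_psi {σ : A.Activation} {k : ℕ} (hσ : A.Admissible k σ) (hk : 2 ≤ k) (m : ℕ)
    (hm : m ≤ 2 * A.L) :
    ContDiff ℝ 1
      (fun p : A.Input × A.Params => psi σ p.2.weights p.2.biases p.1 m) := by
  rw [contDiff_pi]
  intro i
  by_cases ho : Odd m
  · simp only [psi, ho, if_true]
    -- `Admissible` covers only `m < 2L`; the output layer is excluded because `2L` is even.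
    have hlt : m < 2 * A.L := lt_of_le_of_ne hm fun h =>
      (Nat.not_odd_iff_even.2 (even_two_mul A.L)) (h ▸ ho)
    have h2 : ContDiff ℝ (1 + 1) (σ m i) :=
      (hσ m hlt ho i).1.of_le (by rw [one_add_one_eq_two]; exact_mod_cast hk)
    have hl : ContDiff ℝ 1
        (fun p : A.Input × A.Params => layer σ p.2.weights p.2.biases p.1 m) :=
      (contDiff_layer hσ m hm).of_le (by exact_mod_cast (by omega : 1 ≤ k))
    exact (contDiff_succ_iff_deriv.1 h2).2.2.comp (contDiff_pi.1 hl i)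
  · simpa only [psi, ho, if_false] using contDiff_const

theorem contDiff_Z {σ : A.Activation} {k : ℕ} (hσ : A.Admissible k σ) (hk : 2 ≤ k) (m : ℕ)
    (hm : m ≤ 2 * A.L) :
    ContDiff ℝ 1
      (fun p : A.Input × A.Params => Z σ p.2.weights p.2.biases p.1 m) := by
  induction hm using Nat.decreasingInduction with
  | self => simpa only [Z_output] using contDiff_const
  | of_succ m h ih =>
    have h : m < 2 * A.L := h
    simp only [Z_of_lt _ _ _ _ h]
    rw [contDiff_pi]
    intro c
    have hp := contDiff_pi.1 (contDiff_psi hσ hk (m + 1) h)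
    rw [contDiff_pi] at ih
    simp only [Matrix.vecMul, dotProduct, Pi.mul_apply]
    exact ContDiff.sum fun r _ => ((ih r).mul (hp r)).mul (contDiff_weights_apply ⟨m, h⟩ r c)

theorem contDiff_jacobian_apply {σ : A.Activation} {k : ℕ} (hσ : A.Admissible k σ) (hk : 2 ≤ k)
    (m : ℕ) (hm : m ≤ 2 * A.L) (r : Fin (A.d m)) (c : Fin (A.d 0)) :
    ContDiff ℝ 1
      (fun p : A.Input × A.Params => jacobian σ p.2.weights p.2.biases p.1 m r c) := by
  induction m with
  | zero => simpa only [jacobian] using contDiff_const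
  | succ m ih =>
    have h : m < 2 * A.L := hm
    simp only [jacobian_succ _ _ _ _ h, Matrix.mul_apply (M := Params.weights _ _),
      Matrix.diagonal_mul]
    have hp := contDiff_pi.1 (contDiff_psi hσ hk m h.le)
    exact ContDiff.sum fun s _ => (contDiff_weights_apply ⟨m, h⟩ r s).mul ((hp s).mul (ih h.le s))

theorem contDiff_section {E F G : Type*} [NormedAddCommGroup E] [NormedSpace ℝ E]
    [NormedAddCommGroup F] [NormedSpace ℝ F] [NormedAddCommGroup G] [NormedSpace ℝ G]
    {n : WithTop ℕ∞} {f : E × F → G} (hf : ContDiff ℝ n f) (y : F) :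
    ContDiff ℝ n (fun x => f (x, y)) :=
  hf.comp (contDiff_id.prodMk contDiff_const)

/-! ### Gradient and Hessian of the network -/

section Network

variable {σ : A.Activation} {k : ℕ} (hσ : A.Admissible k σ) (hk : 2 ≤ k)
  (W : A.Weights) (b : A.Biases)

include hσ in
theorem contDiff_network : ContDiff ℝ k (network σ W b) :=
  contDiff_pi.1 (contDiff_section (contDiff_layer hσ (2 * A.L) le_rfl) (Params.mk W b)) _

include hσ hk

/-- At `m = 2L` both `Z` and `ψ` are `1`, so `vecMul_jacobian` identifies `Z_0` with the single row
of the output Jacobian. -/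
theorem fderiv_network (x v : A.Input) :
    fderiv ℝ (network σ W b) x v = ∑ i, Z σ W b x 0 i * v i := by
  have hd : DifferentiableAt ℝ (network σ W b) x :=
    ((contDiff_network hσ W b).differentiable (by norm_cast; omega)) x
  have h1 : HasDerivAt (fun t : ℝ => network σ W b (x + t • v))
      (fderiv ℝ (network σ W b) x v) 0 := hd.hasFDerivAt.hasLineDerivAt v
  have h2 := hasDerivAt_pi.1 (hasDerivAt_layer hσ (by omega) W b x v (2 * A.L) le_rfl)
    ⟨0, by rw [A.output_width]; exact Nat.one_pos⟩
  rw [h1.unique h2, ← vecMul_jacobian σ W b x (2 * A.L) le_rfl, Z_output,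
    psi_of_even _ _ _ _ (even_two_mul _)]
  have : Unique (Fin (A.d (2 * A.L))) := by rw [A.output_width]; infer_instance
  simp only [Matrix.mulVec, Matrix.vecMul, dotProduct, Fintype.sum_unique]
  refine Finset.sum_congr rfl fun i _ => ?_
  rw [Subsingleton.elim (default : Fin (A.d (2 * A.L))) ⟨0, by rw [A.output_width]; exact Nat.one_pos⟩]
  simp

theorem isCritical_network_iff (x : A.Input) :
    IsCritical (network σ W b) x ↔ Z σ W b x 0 = 0 := by
  rw [IsCritical, gradient, LinearIsometryEquiv.map_eq_zero_iff]
  constructor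
  · intro h
    funext i
    have := fderiv_network hσ hk W b x (EuclideanSpace.single i 1)
    simpa [h] using this.symm
  · intro h
    ext v
    simp [fderiv_network hσ hk W b, h]

theorem contDiff_Z_input (m : ℕ) (hm : m ≤ 2 * A.L) :
    ContDiff ℝ 1 (fun x => Z σ W b x m) :=
  contDiff_section (contDiff_Z hσ hk m hm) (Params.mk W b)

theorem hessian_network (x : A.Input) (i j : Fin (A.d 0)) :
    hessian (network σ W b) x i j =
      fderiv ℝ (fun y => Z σ W b y 0) x (EuclideanSpace.single i 1) j := by
  have h2 : ContDiff ℝ 2 (network σ W b) :=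
    (contDiff_network hσ W b).of_le (by exact_mod_cast hk)
  have hd : DifferentiableAt ℝ (fderiv ℝ (network σ W b)) x :=
    ((h2.fderiv_right (m := 1) (by norm_num)).differentiable (by norm_num)) x
  have hz : DifferentiableAt ℝ (fun y => Z σ W b y 0) x :=
    ((contDiff_Z_input hσ hk W b 0 (Nat.zero_le _)).differentiable (by norm_num)) x
  have e : (fun y => fderiv ℝ (network σ W b) y (EuclideanSpace.single j 1)) =
      fun y => Z σ W b y 0 j := by
    funext y
    simp [fderiv_network hσ hk W b]
  have e1 := hd.hasFDerivAt.clm_apply (hasFDerivAt_const (EuclideanSpace.single j (1 : ℝ)) x)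
  rw [e] at e1
  have e2 := hasFDerivAt_pi'.1 hz.hasFDerivAt j
  simpa [hessian] using congrArg (fun L => L (EuclideanSpace.single i (1 : ℝ))) (e1.unique e2)

theorem vecMul_hessian_network (x v : A.Input) :
    Matrix.vecMul v.ofLp (hessian (network σ W b) x) = fderiv ℝ (fun y => Z σ W b y 0) x v := by
  have hv : v = ∑ i, v i • EuclideanSpace.single i (1 : ℝ) := by
    simpa using ((EuclideanSpace.basisFun (Fin (A.d 0)) ℝ).sum_repr v).symm
  funext j
  conv_rhs => rw [hv]
  simp [Matrix.vecMul, dotProduct, hessian_network hσ hk W b]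

/-- This puts degeneracy in the form used by Sard's theorem: for an endomorphism in finite
dimension, a nontrivial kernel means failure of surjectivity. -/
theorem det_hessian_network_eq_zero_iff (x : A.Input) :
    (hessian (network σ W b) x).det = 0 ↔
      ¬ Function.Surjective (fderiv ℝ (fun y => Z σ W b y 0) x) := by
  have hinj : Function.Injective (fderiv ℝ (fun y => Z σ W b y 0) x) ↔
      Function.Surjective (fderiv ℝ (fun y => Z σ W b y 0) x) :=
    LinearMap.injective_iff_surjective_of_finrank_eq_finrank
      (f := (fderiv ℝ (fun y => Z σ W b y 0) x).toLinearMap) (by simp)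
  rw [← hinj, injective_iff_map_eq_zero, ← Matrix.exists_vecMul_eq_zero_iff]
  push Not
  constructor
  · rintro ⟨v, hv, h⟩
    refine ⟨WithLp.toLp 2 v, ?_, by simpa using hv⟩
    rw [← vecMul_hessian_network hσ hk W b, h]
  · rintro ⟨v, h, hv⟩
    refine ⟨v.ofLp, by simpa using hv, ?_⟩
    rw [vecMul_hessian_network hσ hk W b, h]

end Network

end Architecture

/-! ### Linear algebra of full-rank matrices -/

namespace Matrix

theorem vecMul_injective_of_rank_eq {p q : ℕ} {M : Matrix (Fin p) (Fin q) ℝ} (h : M.rank = p) :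
    Function.Injective fun v => M.vecMul v := by
  refine vecMul_injective_iff.2 ?_
  rw [linearIndependent_iff_card_eq_finrank_span, Fintype.card_fin, Set.finrank,
    ← M.rank_eq_finrank_span_row, h]

theorem mulVec_injective_of_rank_eq {p q : ℕ} {M : Matrix (Fin p) (Fin q) ℝ} (h : M.rank = q) :
    Function.Injective M.mulVec := by
  refine mulVec_injective_iff.2 ?_
  rw [linearIndependent_iff_card_eq_finrank_span, Fintype.card_fin, Set.finrank,
    ← M.rank_eq_finrank_span_cols, h]

theorem exists_vecMul_eq_of_mulVec_injective {p q : ℕ} {M : Matrix (Fin p) (Fin q) ℝ}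
    (h : Function.Injective M.mulVec) (w : Fin q → ℝ) : ∃ z, M.vecMul z = w := by
  obtain ⟨g, hg⟩ := (toLin' M).exists_leftInverse_of_injective (LinearMap.ker_eq_bot.2 h)
  have hN : LinearMap.toMatrix' g * M = 1 := by
    rw [← LinearMap.toMatrix'_id, ← hg, LinearMap.toMatrix'_comp, LinearMap.toMatrix'_toLin']
  exact ⟨(LinearMap.toMatrix' g).vecMul w, by rw [vecMul_vecMul, hN, vecMul_one]⟩

theorem ae_det_add_smul_one_ne_zero {p : ℕ} (B : Matrix (Fin p) (Fin p) ℝ) :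
    ∀ᵐ t : ℝ, (B + t • (1 : Matrix (Fin p) (Fin p) ℝ)).det ≠ 0 := by
  have hfin : {t : ℝ | (B + t • (1 : Matrix (Fin p) (Fin p) ℝ)).det = 0}.Finite := by
    -- The determinant is the characteristic polynomial of `-B` at `t`, which is monic and so has
    -- finitely many roots.
    refine ((-B).charpoly.roots.toFinset.finite_toSet).subset fun t ht => ?_
    simp only [Finset.mem_coe, Multiset.mem_toFinset,
      Polynomial.mem_roots (charpoly_monic _).ne_zero, Polynomial.IsRoot.def, eval_charpoly]
    rw [← ht, sub_neg_eq_add, add_comm, scalar_apply, smul_one_eq_diagonal]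
  simpa using hfin.countable.ae_notMem volume

end Matrix

/-! ### Almost all weights have full rank -/

namespace Architecture

variable {A : Architecture}

theorem continuous_weights_apply (m : Fin (2 * A.L)) (r : Fin (A.d (m + 1))) (c : Fin (A.d m)) :
    Continuous fun θ : A.Params => θ.weights m r c :=
  continuous_apply _

/-- The leading maximal minor is nonzero almost everywhere: along every line in the direction of a
truncated identity it vanishes at finitely many points only, and Fubini applies. -/
theorem ae_rank_weights_eq (m : Fin (2 * A.L)) :
    ∀ᵐ θ : A.Params, (θ.weights m).rank = min (A.d (m + 1)) (A.d m) := by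
  let e₁ : Fin (min (A.d (m + 1)) (A.d m)) → Fin (A.d (m + 1)) := Fin.castLE (min_le_left _ _)
  let e₂ : Fin (min (A.d (m + 1)) (A.d m)) → Fin (A.d m) := Fin.castLE (min_le_right _ _)
  have hmain : ∀ᵐ θ : A.Params, θ ∈ {θ : A.Params | ((θ.weights m).submatrix e₁ e₂).det ≠ 0} := by
    let v : A.Params :=
      Params.mk (fun m' r c => if m' = m ∧ (r : ℕ) = c then 1 else 0) 0
    refine ae_mem_of_ae_add_linearMap_mem (LinearMap.toSpanSingleton ℝ A.Params v) volume volume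
      ?_ fun θ => ?_
    · refine (isOpen_ne_fun (Continuous.matrix_det ?_) continuous_const).measurableSet
      exact continuous_matrix fun r c => continuous_weights_apply m _ _
    · filter_upwards [Matrix.ae_det_add_smul_one_ne_zero ((θ.weights m).submatrix e₁ e₂)] with t ht
      convert ht using 2
      ext r c
      simp [Params.weights, v, Params.mk, e₁, e₂, Matrix.one_apply, Fin.ext_iff]
  filter_upwards [hmain] with θ hθ
  refine le_antisymm (le_min (Matrix.rank_le_height _) (Matrix.rank_le_width _)) ?_
  have h1 : ((θ.weights m).submatrix e₁ e₂).rank = min (A.d (m + 1)) (A.d m) := by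
    rw [Matrix.rank_of_isUnit _ ((Matrix.isUnit_iff_isUnit_det _).2 (isUnit_iff_ne_zero.2 hθ)),
      Fintype.card_fin]
  rw [← h1]
  exact Matrix.rank_submatrix_le _ _ _

theorem ae_weights_mem_fullRank : ∀ᵐ θ : A.Params, θ.weights ∈ A.fullRank :=
  ae_all_iff.2 ae_rank_weights_eq

/-! ### Propagation of `Z` to the gradient -/

section Propagation

variable {σ : A.Activation} {k : ℕ} (hσ : A.Admissible k σ) (W : A.Weights) (b : A.Biases)
  (x : A.Input)

include hσ in
theorem psi_ne_zero {m : ℕ} (hm : m < 2 * A.L) (i : Fin (A.d m)) : psi σ W b x m i ≠ 0 := by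
  by_cases ho : Odd m
  · simp only [psi, ho, if_true]
    rcases (hσ m hm ho i).2 with h | h
    · exact (h _).ne'
    · exact (h _).ne
  · simp [psi, ho]

include hσ in
theorem mul_psi_ne_zero {m : ℕ} (hm : m < 2 * A.L) {z : Fin (A.d m) → ℝ} (hz : z ≠ 0) :
    z * psi σ W b x m ≠ 0 := by
  obtain ⟨i, hi⟩ := Function.ne_iff.1 hz
  exact Function.ne_iff.2 ⟨i, mul_ne_zero hi (psi_ne_zero hσ W b x hm i)⟩

include hσ in
-- Each step towards the input multiplies by an invertible diagonal and by a matrix with independent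
-- rows, so no nonzero row vector is killed.
theorem Z_zero_ne_zero (hW : W ∈ A.fullRank) {m : ℕ} (hm : m < 2 * A.L)
    (hd : ∀ l < m, A.d (l + 1) ≤ A.d l) (hZ : Z σ W b x m ≠ 0) : Z σ W b x 0 ≠ 0 := by
  induction m with
  | zero => exact hZ
  | succ m ih =>
    have h : m < 2 * A.L := by omega
    refine ih h (fun l hl => hd l (by omega)) ?_
    rw [Z_of_lt _ _ _ _ h]
    intro h0
    have hr : (W ⟨m, h⟩).rank = A.d (m + 1) := by
      rw [hW ⟨m, h⟩]
      exact min_eq_left (hd m (Nat.lt_succ_self m))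
    refine mul_psi_ne_zero hσ W b x hm hZ (Matrix.vecMul_injective_of_rank_eq hr ?_)
    simpa using h0

theorem Z_zero_eq_zero {m : ℕ} (hm : m ≤ 2 * A.L) (hZ : Z σ W b x m = 0) : Z σ W b x 0 = 0 := by
  rw [← vecMul_jacobian σ W b x m hm, hZ, zero_mul, Matrix.zero_vecMul]

include hσ in
theorem jacobian_mulVec_injective (hW : W ∈ A.fullRank) {m : ℕ} (hm : m ≤ 2 * A.L)
    (hd : ∀ l < m, A.d l ≤ A.d (l + 1)) : Function.Injective (jacobian σ W b x m).mulVec := by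
  induction m with
  | zero =>
    intro v w h
    simpa [jacobian] using h
  | succ m ih =>
    have h : m < 2 * A.L := hm
    have hr : (W ⟨m, h⟩).rank = A.d m := by
      rw [hW ⟨m, h⟩]
      exact min_eq_right (hd m (Nat.lt_succ_self m))
    intro v w hvw
    rw [jacobian_succ _ _ _ _ h] at hvw
    simp only [← Matrix.mulVec_mulVec] at hvw
    refine ih h.le (fun l hl => hd l (by omega)) ?_
    have h1 := Matrix.mulVec_injective_of_rank_eq hr hvw
    funext i
    have h2 := congrFun h1 i
    simp only [Matrix.mulVec_diagonal] at h2
    exact mul_left_cancel₀ (psi_ne_zero hσ W b x h i) h2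

end Propagation

theorem lt_of_firstBottleneckAt {j : ℕ} (h : A.FirstBottleneckAt j) : j < 2 * A.L := by
  obtain ⟨⟨i, l, -, hl, hl', -⟩, -⟩ := h
  omega

theorem DecreasesTo.antitone {j : ℕ} (h : A.DecreasesTo j) (l : ℕ) (hl : l < j) :
    A.d (l + 1) ≤ A.d l := by
  obtain ⟨h0, h1, h2⟩ := h
  rcases Nat.lt_or_ge (l + 1) j with h | h
  · exact h1 l h
  · obtain rfl : j = l + 1 := by omega
    exact h2.le

theorem DecreasesTo.lt_input {j : ℕ} (h : A.DecreasesTo j) : A.d j < A.d 0 := by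
  have : ∀ m < j, A.d m ≤ A.d 0 := by
    intro m
    induction m with
    | zero => exact fun _ => le_rfl
    | succ m ih => exact fun hm => (h.antitone m (by omega)).trans (ih (by omega))
  exact h.2.2.trans_le (this _ (Nat.sub_lt h.1 one_pos))

/-! ### Degenerate critical points below a bottleneck -/

/-- In `D(q J) = Dq · J + q · DJ` the second term vanishes at a zero of `q`, so the Hessian has rank
at most `d_j < d_0`. -/
theorem isDegenerateCritical_of_Z_eq_zero {σ : A.Activation} {k : ℕ} (hσ : A.Admissible k σ)
    (hk : 2 ≤ k) (W : A.Weights) (b : A.Biases) (x : A.Input) {j : ℕ} (hj : j ≤ 2 * A.L)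
    (hd : A.d j < A.d 0) (hZ : Z σ W b x j = 0) : IsDegenerateCritical (network σ W b) x := by
  refine ⟨(isCritical_network_iff hσ hk W b x).2 (Z_zero_eq_zero W b x hj hZ),
    (det_hessian_network_eq_zero_iff hσ hk W b x).2 fun hs => ?_⟩
  let q : A.Input → Fin (A.d j) → ℝ := fun y => Z σ W b y j * psi σ W b y j
  have hq0 : q x = 0 := by simp [q, hZ]
  have hq : DifferentiableAt ℝ q x :=
    (((contDiff_section (contDiff_Z hσ hk j hj) (Params.mk W b)).differentiable (by norm_num)).mul
      ((contDiff_section (contDiff_psi hσ hk j hj) (Params.mk W b)).differentiable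
        (by norm_num))) x
  have hJ : ∀ r c, DifferentiableAt ℝ (fun y => jacobian σ W b y j r c) x := fun r c =>
    ((contDiff_section (contDiff_jacobian_apply hσ hk j hj r c) (Params.mk W b)).differentiable
      (by norm_num)) x
  have hZ0 : DifferentiableAt ℝ (fun y => Z σ W b y 0) x :=
    ((contDiff_Z_input hσ hk W b 0 (Nat.zero_le _)).differentiable (by norm_num)) x
  have hval : ∀ v, fderiv ℝ (fun y => Z σ W b y 0) x v =
      (jacobian σ W b x j).vecMul (fderiv ℝ q x v) := by
    intro v
    funext c
    have h1 := hasFDerivAt_pi'.1 hZ0.hasFDerivAt c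
    have h2 : HasFDerivAt (fun y => ∑ r, q y r * jacobian σ W b y j r c) _ x :=
      HasFDerivAt.fun_sum fun r _ => (hasFDerivAt_pi'.1 hq.hasFDerivAt r).mul (hJ r c).hasFDerivAt
    have e : (fun y => Z σ W b y 0 c) = fun y => ∑ r, q y r * jacobian σ W b y j r c := by
      funext y
      rw [← vecMul_jacobian σ W b y j hj]
      rfl
    rw [e] at h1
    have h3 := congrArg (fun L => L v) (h1.unique h2)
    simpa [hq0, Matrix.vecMul, dotProduct, mul_comm] using h3
  have hsur : Function.Surjective (jacobian σ W b x j).vecMulLinear := fun w => by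
    obtain ⟨v, hv⟩ := hs w
    exact ⟨fderiv ℝ q x v, by rw [← hv, hval]; rfl⟩
  have := LinearMap.finrank_le_finrank_of_surjective hsur
  simp at this
  omega

/-! ### Perturbations of a layer that fix all layers at a given input -/

section Shift

variable (σ : A.Activation) (θ : A.Params) (x : A.Input) (m₀ : Fin (2 * A.L))
  (B : Matrix (Fin (A.d (m₀ + 1))) (Fin (A.d m₀)) ℝ)

/-- The direction in parameter space that changes the weight matrix into the layer `m₀ + 1` by `B`
and compensates for this at the input `x` by a change of the bias. -/
def shift : A.Params :=
  Params.mk (Pi.single m₀ B)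
    (Pi.single m₀ (-B.mulVec (activate σ m₀ (layer σ θ.weights θ.biases x m₀))))

theorem weights_add_smul_shift (t : ℝ) (m : Fin (2 * A.L)) :
    (θ + t • shift σ θ x m₀ B : A.Params).weights m =
      θ.weights m + t • (Pi.single m₀ B : A.Weights) m := by
  ext r c
  simp [Params.weights, shift, Params.mk]

theorem biases_add_smul_shift (t : ℝ) (m : Fin (2 * A.L)) :
    (θ + t • shift σ θ x m₀ B : A.Params).biases m = θ.biases m +
      t • (Pi.single m₀ (-B.mulVec (activate σ m₀ (layer σ θ.weights θ.biases x m₀))) :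
        A.Biases) m := by
  ext r
  simp [Params.biases, shift, Params.mk]

theorem layer_add_smul_shift (t : ℝ) {m : ℕ} (hm : m ≤ 2 * A.L) :
    layer σ (θ + t • shift σ θ x m₀ B : A.Params).weights
      (θ + t • shift σ θ x m₀ B : A.Params).biases x m = layer σ θ.weights θ.biases x m := by
  induction m with
  | zero => rfl
  | succ m ih =>
    have h : m < 2 * A.L := hm
    rw [layer_succ _ _ _ _ h, layer_succ _ _ _ _ h, ih h.le, weights_add_smul_shift,
      biases_add_smul_shift]
    by_cases hmm : (⟨m, h⟩ : Fin (2 * A.L)) = m₀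
    · subst hmm
      simp only [Pi.single_eq_same, Matrix.add_mulVec, Matrix.smul_mulVec, smul_neg]
      abel
    · simp [Pi.single_eq_of_ne hmm]

theorem psi_add_smul_shift (t : ℝ) {m : ℕ} (hm : m ≤ 2 * A.L) :
    psi σ (θ + t • shift σ θ x m₀ B : A.Params).weights
      (θ + t • shift σ θ x m₀ B : A.Params).biases x m = psi σ θ.weights θ.biases x m := by
  funext i
  simp only [psi, layer_add_smul_shift σ θ x m₀ B t hm]

theorem jacobian_add_smul_shift (t : ℝ) {m : ℕ} (hm : m ≤ m₀) :
    jacobian σ (θ + t • shift σ θ x m₀ B : A.Params).weights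
      (θ + t • shift σ θ x m₀ B : A.Params).biases x m = jacobian σ θ.weights θ.biases x m := by
  induction m with
  | zero => rfl
  | succ m ih =>
    have h : m < 2 * A.L := by omega
    have hne : (⟨m, h⟩ : Fin (2 * A.L)) ≠ m₀ := by
      rintro rfl
      simp at hm
    rw [jacobian_succ _ _ _ _ h, jacobian_succ _ _ _ _ h, ih (by omega), weights_add_smul_shift,
      psi_add_smul_shift _ _ _ _ _ _ h.le, Pi.single_eq_of_ne hne, smul_zero, add_zero]

theorem Z_add_smul_shift (t : ℝ) {m : ℕ} (hm : m ≤ 2 * A.L) (hm' : m₀ < m) :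
    Z σ (θ + t • shift σ θ x m₀ B : A.Params).weights
      (θ + t • shift σ θ x m₀ B : A.Params).biases x m = Z σ θ.weights θ.biases x m := by
  induction hm using Nat.decreasingInduction with
  | self => rw [Z_output, Z_output]
  | of_succ m h ih =>
    have hne : (⟨m, h⟩ : Fin (2 * A.L)) ≠ m₀ := by
      rintro rfl
      simp at hm'
    rw [Z_of_lt _ _ _ _ h, Z_of_lt _ _ _ _ h, ih (by omega), weights_add_smul_shift,
      psi_add_smul_shift _ _ _ _ _ _ h, Pi.single_eq_of_ne hne, smul_zero, add_zero]

/-- The shift fixes all layers at `x`, hence all `ψ`, the factors `Z` above it and the Jacobian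
below it. Only one matrix in the product moves, so the dependence on `t` is exactly affine. -/
theorem Z_zero_add_smul_shift (t : ℝ) :
    Z σ (θ + t • shift σ θ x m₀ B : A.Params).weights
      (θ + t • shift σ θ x m₀ B : A.Params).biases x 0 = Z σ θ.weights θ.biases x 0 +
      t • Matrix.vecMul (Matrix.vecMul
        (Z σ θ.weights θ.biases x (m₀ + 1) * psi σ θ.weights θ.biases x (m₀ + 1)) B *
          psi σ θ.weights θ.biases x m₀) (jacobian σ θ.weights θ.biases x m₀) := by
  have h : (m₀ : ℕ) < 2 * A.L := m₀.2
  rw [← vecMul_jacobian _ _ _ _ m₀ h.le, ← vecMul_jacobian σ θ.weights _ _ m₀ h.le,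
    Z_of_lt _ _ _ _ h, Z_of_lt _ _ _ _ h, jacobian_add_smul_shift _ _ _ _ _ _ le_rfl,
    psi_add_smul_shift _ _ _ _ _ _ h, psi_add_smul_shift _ _ _ _ _ _ h.le,
    Z_add_smul_shift _ _ _ _ _ _ h (Nat.lt_succ_self _), weights_add_smul_shift]
  simp only [Fin.eta, Pi.single_eq_same]
  rw [Matrix.vecMul_add, Matrix.vecMul_smul, add_mul, Matrix.add_vecMul, smul_mul_assoc,
    Matrix.smul_vecMul]

end Shift

/-! ### Almost all networks are Morse functions away from the zeros of `Z` -/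

theorem surjective_fderiv_Z_zero {σ : A.Activation} {k : ℕ} (hσ : A.Admissible k σ)
    (hk : 2 ≤ k) (θ : A.Params) (x : A.Input) (hθ : θ.weights ∈ A.fullRank) {m : ℕ}
    (hm : m + 1 < 2 * A.L) (hd : ∀ l < m, A.d l ≤ A.d (l + 1))
    (hZ : Z σ θ.weights θ.biases x (m + 1) ≠ 0) :
    Function.Surjective fun v : A.Params =>
      fderiv ℝ (fun p : A.Input × A.Params => Z σ p.2.weights p.2.biases p.1 0) (x, θ) (0, v) := by
  intro w
  have h : m < 2 * A.L := by omega
  obtain ⟨z, hz⟩ := Matrix.exists_vecMul_eq_of_mulVec_injective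
    (jacobian_mulVec_injective hσ θ.weights θ.biases x hθ h.le hd) w
  obtain ⟨r, hr⟩ := Function.ne_iff.1 (mul_psi_ne_zero hσ θ.weights θ.biases x hm hZ)
  set u := Z σ θ.weights θ.biases x (m + 1) * psi σ θ.weights θ.biases x (m + 1)
  -- A single row, at an index where `u` is nonzero, suffices to make `u B` equal to `z / ψ_m`.
  let B : Matrix (Fin (A.d (m + 1))) (Fin (A.d m)) ℝ :=
    Matrix.vecMulVec (Pi.single r (u r)⁻¹) fun c => z c / psi σ θ.weights θ.biases x m c
  have hB : Matrix.vecMul u B * psi σ θ.weights θ.biases x m = z := by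
    funext c
    have h1 := psi_ne_zero hσ θ.weights θ.biases x h c
    have h2 : u r ≠ 0 := hr
    simp only [B, Matrix.vecMul_vecMulVec, Pi.mul_apply, Pi.smul_apply, dotProduct_single]
    simp [h1, h2]
  refine ⟨shift σ θ x ⟨m, h⟩ B, ?_⟩
  have hF : DifferentiableAt ℝ
      (fun p : A.Input × A.Params => Z σ p.2.weights p.2.biases p.1 0) (x, θ) :=
    ((contDiff_Z hσ hk 0 (Nat.zero_le _)).differentiable (by norm_num)) _
  have h1 : HasDerivAt (fun t : ℝ => Z σ ((x, θ) + t • ((0 : A.Input), shift σ θ x ⟨m, h⟩ B)).2.weights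
      ((x, θ) + t • ((0 : A.Input), shift σ θ x ⟨m, h⟩ B)).2.biases
      ((x, θ) + t • ((0 : A.Input), shift σ θ x ⟨m, h⟩ B)).1 0) _ 0 :=
    hF.hasFDerivAt.hasLineDerivAt ((0 : A.Input), shift σ θ x ⟨m, h⟩ B)
  have h2 : HasDerivAt (fun t : ℝ => Z σ θ.weights θ.biases x 0 + t • w) w 0 := by
    simpa using ((hasDerivAt_id (0 : ℝ)).smul_const w).const_add (Z σ θ.weights θ.biases x 0)
  refine h1.unique (h2.congr_of_eventuallyEq (Filter.Eventually.of_forall fun t => ?_))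
  simp only [Prod.fst_add, Prod.snd_add, Prod.smul_fst, Prod.smul_snd, smul_zero, add_zero]
  rw [Z_zero_add_smul_shift σ θ x ⟨m, h⟩ B t, ← hz, ← hB]

theorem ae_isNondegenerateCritical {σ : A.Activation} {k : ℕ} (hσ : A.Admissible k σ)
    (hk : 2 ≤ k) {m : ℕ} (hm : m + 1 < 2 * A.L) (hd : ∀ l < m, A.d l ≤ A.d (l + 1)) :
    ∀ᵐ θ : A.Params, ∀ x, Z σ θ.weights θ.biases x (m + 1) ≠ 0 →
      IsCritical (network σ θ.weights θ.biases) x →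
        IsNondegenerateCritical (network σ θ.weights θ.biases) x := by
  have hF : ContDiff ℝ 1 (fun p : A.Input × A.Params => Z σ p.2.weights p.2.biases p.1 0) :=
    contDiff_Z hσ hk 0 (Nat.zero_le _)
  have hsard := measure_singular_parameters_eq_zero (volume : Measure A.Params) hF (by simp)
  filter_upwards [ae_weights_mem_fullRank, measure_eq_zero_iff_ae_notMem.1 hsard] with θ hθ hs x
    hZ hc
  refine ⟨hc, fun hdet => hs ⟨x, (isCritical_network_iff hσ hk _ _ x).1 hc,
    surjective_fderiv_Z_zero hσ hk θ x hθ hm hd hZ, ?_⟩⟩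
  have hdet := (det_hessian_network_eq_zero_iff hσ hk θ.weights θ.biases x).1 hdet
  have hx : HasFDerivAt (fun y : A.Input => (y, θ)) (ContinuousLinearMap.inl ℝ A.Input A.Params)
      x := hasFDerivAt_prodMk_left x θ
  have hcomp := (((hF.differentiable (by norm_num)) (x, θ)).hasFDerivAt.comp x hx).fderiv
  have hcomp : fderiv ℝ (fun y => Z σ θ.weights θ.biases y 0) x = _ := hcomp
  rw [hcomp] at hdet
  exact hdet

end Architecture

/-- Stated for a variable `p`, since the widths of `alternating` enter through equations. -/
theorem Fin.sum_of_eq_one {p : ℕ} (hp : p = 1) (f : Fin p → ℝ) :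
    ∑ i, f i = f ⟨0, by omega⟩ := by
  subst hp
  exact Fin.sum_univ_one f

theorem Fin.sum_of_eq_two {p : ℕ} (hp : p = 2) (f : Fin p → ℝ) :
    ∑ i, f i = f ⟨0, by omega⟩ + f ⟨1, by omega⟩ := by
  subst hp
  exact Fin.sum_univ_two f

namespace Architecture

/-! ### An architecture with an augmented bottleneck -/

/-- The architecture with layer widths `1, 2, 1, 2, 1`. -/
def alternating : Architecture where
  L := 2
  d j := if j % 2 = 1 then 2 else 1
  one_le_L := by norm_num
  output_width := rfl

theorem alternating_lt {m : ℕ} (h : m < 4) : m < 2 * alternating.L := h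

theorem alternating_d_of_odd {m : ℕ} (h : Odd m) : alternating.d m = 2 :=
  if_pos (Nat.odd_iff.1 h)

theorem alternating_d_of_even {m : ℕ} (h : Even m) : alternating.d m = 1 :=
  if_neg (by simp [Nat.even_iff.1 h])

/-- The only index of the input layer. -/
def inputIndex : Fin (alternating.d 0) := 
  ⟨0, by simp [alternating_d_of_even]⟩

/-- All activation functions are the identity, except for the second one in layer `3`, which is
`t + sin t / 2`. -/
def alternatingActivation : alternating.Activation := fun j r t =>
  if j = 3 ∧ (r : ℕ) = 1 then t + Real.sin t / 2 else t

/-- Weights for which the network is `x ↦ a * x + (x + sin x / 2)`. -/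
def alternatingWeights (a : ℝ) : alternating.Weights := fun j => Matrix.of fun _ c =>
  if (j : ℕ) = 3 ∧ (c : ℕ) = 0 then a else if (j : ℕ) = 1 ∧ (c : ℕ) = 1 then 0 else 1

theorem alternating_firstBottleneckAt : alternating.FirstBottleneckAt 2 := by
  constructor
  · refine ⟨1, 3, ?_⟩
    simp [alternating]
  · rintro j hj ⟨i, l, hi, -, -, h, -⟩
    obtain rfl : j = 1 := by omega
    obtain rfl : i = 0 := by omega
    simp [alternating] at h

theorem alternating_increasesTo : alternating.IncreasesTo 1 := by
  refine ⟨one_pos, fun m hm => by omega, ?_⟩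
  simp [alternating]

theorem deriv_add_sin_half (t : ℝ) :
    deriv (fun t : ℝ => t + Real.sin t / 2) t = 1 + Real.cos t / 2 :=
  ((hasDerivAt_id t).add ((Real.hasDerivAt_sin t).div_const 2)).deriv

theorem alternating_admissible (k : ℕ) : alternating.Admissible k alternatingActivation := by
  intro j _ _ r
  by_cases h : j = 3 ∧ (r : ℕ) = 1
  · have e : alternatingActivation j r = fun t => t + Real.sin t / 2 := by
      funext t
      simp only [alternatingActivation, h, and_self, if_true]
    rw [e]
    refine ⟨contDiff_id.add (Real.contDiff_sin.div_const 2), Or.inl fun t => ?_⟩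
    rw [deriv_add_sin_half]
    linarith [Real.neg_one_le_cos t]
  · have e : alternatingActivation j r = fun t => t := by
      funext t
      simp only [alternatingActivation, h, if_false]
    rw [e]
    exact ⟨contDiff_id, Or.inl fun t => by simp⟩

theorem alternatingWeights_mem_fullRank {a : ℝ} (ha : a ≠ 0) :
    alternatingWeights a ∈ alternating.fullRank := by
  intro j
  have hd : ∀ m, 0 < alternating.d m := fun m => by
    simp only [alternating]
    split_ifs <;> norm_num
  have hmin : min (alternating.d (j + 1)) (alternating.d j) = 1 := by
    simp only [alternating]
    split_ifs <;> first | rfl | omega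
  refine le_antisymm (le_min (Matrix.rank_le_height _) (Matrix.rank_le_width _)) ?_
  rw [hmin]
  have hne : alternatingWeights a j ⟨0, hd _⟩ ⟨0, hd _⟩ ≠ 0 := by
    simp only [alternatingWeights, Matrix.of_apply, and_true]
    split_ifs with h1 h2
    · exact ha
    · simp at h2
    · exact one_ne_zero
  let M := (alternatingWeights a j).submatrix (fun _ : Fin 1 => ⟨0, hd _⟩)
    (fun _ : Fin 1 => ⟨0, hd _⟩)
  have hM : IsUnit M := by
    rw [Matrix.isUnit_iff_isUnit_det, Matrix.det_fin_one]
    exact isUnit_iff_ne_zero.2 hne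
  calc 1 = M.rank := by rw [Matrix.rank_of_isUnit _ hM, Fintype.card_fin]
    _ ≤ _ := Matrix.rank_submatrix_le _ _ _

theorem layer_alternating (a : ℝ) (x : alternating.Input) (c : Fin (alternating.d 3)) :
    layer alternatingActivation (alternatingWeights a) 0 x 3 c = x inputIndex := by
  have h1 : ∀ r, layer alternatingActivation (alternatingWeights a) 0 x 1 r = x inputIndex := by
    intro r
    rw [layer_succ _ _ _ _ (alternating_lt (by decide : 0 < 4))]
    simp only [Pi.add_apply, Matrix.mulVec, dotProduct]
    rw [Fin.sum_of_eq_one (alternating_d_of_even (by decide))]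
    simp [alternatingWeights, activate, layer, inputIndex]
  have h2 : ∀ r, layer alternatingActivation (alternatingWeights a) 0 x 2 r = x inputIndex := by
    intro r
    rw [layer_succ _ _ _ _ (alternating_lt (by decide : 1 < 4))]
    simp only [Pi.add_apply, Matrix.mulVec, dotProduct]
    rw [Fin.sum_of_eq_two (alternating_d_of_odd (by decide))]
    simp [alternatingWeights, activate, h1, alternatingActivation]
  rw [layer_succ _ _ _ _ (alternating_lt (by decide : 2 < 4))]
  simp only [Pi.add_apply, Matrix.mulVec, dotProduct]
  rw [Fin.sum_of_eq_one (alternating_d_of_even (by decide))]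
  simp [alternatingWeights, activate, h2, Nat.not_odd_iff_even.2 even_two]

theorem psi_three_alternating (a : ℝ) (x : alternating.Input) (c : Fin (alternating.d 3)) :
    psi alternatingActivation (alternatingWeights a) 0 x 3 c =
      if (c : ℕ) = 1 then 1 + Real.cos (x inputIndex) / 2 else 1 := by
  simp only [psi, layer_alternating, if_pos (by decide : Odd 3)]
  split_ifs with h
  · have e : alternatingActivation 3 c = fun t => t + Real.sin t / 2 := by
      funext t
      simp [alternatingActivation, h]
    rw [e, deriv_add_sin_half]
  · have e : alternatingActivation 3 c = fun t => t := by
      funext t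
      simp [alternatingActivation, h]
    rw [e, deriv_id'']

theorem Z_two_alternating (a : ℝ) (x : alternating.Input) (c : Fin (alternating.d 2)) :
    Z alternatingActivation (alternatingWeights a) 0 x 2 c =
      a + 1 + Real.cos (x inputIndex) / 2 := by
  have h4 : ∀ c, Z alternatingActivation (alternatingWeights a) 0 x 4 c = 1 := fun c =>
    congrFun (Z_output alternatingActivation (alternatingWeights a) 0 x) c
  have h3 : ∀ c, Z alternatingActivation (alternatingWeights a) 0 x 3 c =
      if (c : ℕ) = 0 then a else 1 := by
    intro c
    rw [Z_of_lt _ _ _ _ (alternating_lt (by decide : 3 < 4))]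
    simp only [Matrix.vecMul, dotProduct]
    rw [Fin.sum_of_eq_one (alternating_d_of_even (by decide))]
    simp [h4, psi_of_even _ _ _ _ (by decide : Even 4), alternatingWeights]
  rw [Z_of_lt _ _ _ _ (alternating_lt (by decide : 2 < 4))]
  simp only [Matrix.vecMul, dotProduct]
  rw [Fin.sum_of_eq_two (alternating_d_of_odd (by decide))]
  simp [h3, psi_three_alternating, alternatingWeights]
  ring

/-- As `V_2 = (1, 0)`, `Z_1` vanishes precisely where the derivative of the network does, so every
critical point is a zero of `Z_1`. -/
theorem Z_one_alternating (a : ℝ) (x : alternating.Input) (c : Fin (alternating.d 1)) :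
    Z alternatingActivation (alternatingWeights a) 0 x 1 c =
      if (c : ℕ) = 1 then 0 else a + 1 + Real.cos (x inputIndex) / 2 := by
  rw [Z_of_lt _ _ _ _ (alternating_lt (by decide : 1 < 4))]
  simp only [Matrix.vecMul, dotProduct]
  rw [Fin.sum_of_eq_one (alternating_d_of_even (by decide))]
  simp [Z_two_alternating, psi_of_even _ _ _ _ (by decide : Even 2), alternatingWeights]

theorem Z_zero_alternating (a : ℝ) (x : alternating.Input) (c : Fin (alternating.d 0)) :
    Z alternatingActivation (alternatingWeights a) 0 x 0 c =
      a + 1 + Real.cos (x inputIndex) / 2 := by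
  have e : ∀ r, psi alternatingActivation (alternatingWeights a) 0 x 1 r = 1 := by
    intro r
    have : alternatingActivation 1 r = fun t => t := by
      funext t
      simp [alternatingActivation]
    rw [psi, if_pos odd_one, this, deriv_id'']
  rw [Z_of_lt _ _ _ _ (alternating_lt (by decide : 0 < 4))]
  simp only [Matrix.vecMul, dotProduct]
  rw [Fin.sum_of_eq_two (alternating_d_of_odd (by decide))]
  simp [Z_one_alternating, e, alternatingWeights]

theorem isCritical_alternating_iff (a : ℝ) (x : alternating.Input) :
    IsCritical (network alternatingActivation (alternatingWeights a) 0) x ↔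
      a + 1 + Real.cos (x inputIndex) / 2 = 0 := by
  rw [isCritical_network_iff (alternating_admissible 2) le_rfl]
  exact ⟨fun h => (Z_zero_alternating a x inputIndex).symm.trans (congrFun h _),
    fun h => funext fun c => (Z_zero_alternating a x c).trans h⟩

theorem Z_one_alternating_eq_zero {a : ℝ} {x : alternating.Input}
    (h : a + 1 + Real.cos (x inputIndex) / 2 = 0) :
    Z alternatingActivation (alternatingWeights a) 0 x 1 = 0 := by
  funext c
  rw [Z_one_alternating, h, ite_self]
  rfl

theorem det_hessian_alternating (a : ℝ) (x : alternating.Input) :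
    (hessian (network alternatingActivation (alternatingWeights a) 0) x).det =
      -Real.sin (x inputIndex) / 2 := by
  -- `alternating.d 0` reduces to `1`, so the Hessian is a `1 × 1` matrix up to unfolding.
  refine (Matrix.det_fin_one _).trans ?_
  refine (hessian_network (alternating_admissible 2) le_rfl _ _ x inputIndex (0 : Fin 1)).trans ?_
  have hZ : DifferentiableAt ℝ
      (fun y => Z alternatingActivation (alternatingWeights a) 0 y 0) x :=
    ((contDiff_Z_input (alternating_admissible 2) le_rfl _ _ 0 (Nat.zero_le _)).differentiable
      (by norm_num)) x
  have h1 := hasDerivAt_pi.1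
    (hZ.hasFDerivAt.hasLineDerivAt (EuclideanSpace.single inputIndex (1 : ℝ))) inputIndex
  simp only [Z_zero_alternating] at h1
  have h2 : HasDerivAt (fun t : ℝ => a + 1 + Real.cos (x inputIndex + t) / 2)
      (-Real.sin (x inputIndex) / 2) 0 := by
    have := (((Real.hasDerivAt_cos (x inputIndex + 0)).comp (0 : ℝ)
      ((hasDerivAt_id (0 : ℝ)).const_add (x inputIndex))).div_const 2).const_add (a + 1)
    simpa using this
  refine h1.unique (h2.congr_of_eventuallyEq (Filter.Eventually.of_forall fun t => ?_))
  simp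

end Architecture

open Architecture in
theorem exists_degenerate_and_nondegenerate (k : ℕ) :
    ∃ (A : Architecture) (σ : A.Activation) (X : Set A.Input) (i j : ℕ),
      (∀ m ≤ 2 * A.L, 0 < A.d m) ∧ A.Admissible k σ ∧ IsOpen X ∧
      A.FirstBottleneckAt j ∧ i < j ∧ A.IncreasesTo i ∧
      (∃ W ∈ A.fullRank, ∃ b : A.Biases,
        (∃ x ∈ X, Architecture.Z σ W b x i = 0 ∧
          IsDegenerateCritical (Architecture.network σ W b) x) ∧
        ClassC3 k X (Architecture.network σ W b)) ∧
      (∃ W ∈ A.fullRank, ∃ b : A.Biases,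
        (∃ x ∈ X, Architecture.Z σ W b x i = 0 ∧
          IsNondegenerateCritical (Architecture.network σ W b) x) ∧
        ClassC2 k X (Architecture.network σ W b)) := by
  have hC := fun W b => (contDiff_network (alternating_admissible k) W b).contDiffOn (s := Set.univ)
  refine ⟨alternating, alternatingActivation, Set.univ, 1, 2, fun m _ => ?_,
    alternating_admissible k, isOpen_univ, alternating_firstBottleneckAt, one_lt_two,
    alternating_increasesTo, ?_, ?_⟩
  · simp only [alternating]
    split_ifs <;> norm_num
  -- With `a = -3/2` the derivative `(cos x - 1) / 2` has a double zero at `0`.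
  · have h0 : (-3 / 2 : ℝ) + 1 + Real.cos ((0 : alternating.Input) inputIndex) / 2 = 0 := by
      simp
      norm_num
    have hd : IsDegenerateCritical
        (network alternatingActivation (alternatingWeights (-3 / 2)) 0) 0 :=
      ⟨(isCritical_alternating_iff _ _).2 h0, by simp [det_hessian_alternating]⟩
    exact ⟨alternatingWeights (-3 / 2), alternatingWeights_mem_fullRank (by norm_num), 0,
      ⟨0, Set.mem_univ _, Z_one_alternating_eq_zero h0, hd⟩, hC _ _, 0, Set.mem_univ _, hd⟩
  -- With `a = -1` the derivative is `cos x / 2`, whose zeros are all simple.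
  · let x : alternating.Input := EuclideanSpace.single inputIndex (Real.pi / 2)
    have h0 : (-1 : ℝ) + 1 + Real.cos (x inputIndex) / 2 = 0 := by
      simp [x]
    have hnd : ∀ y, IsCritical (network alternatingActivation (alternatingWeights (-1)) 0) y →
        IsNondegenerateCritical (network alternatingActivation (alternatingWeights (-1)) 0) y := by
      refine fun y hy => ⟨hy, ?_⟩
      rw [isCritical_alternating_iff] at hy
      have hc : Real.cos (y inputIndex) = 0 := by linarith
      rw [det_hessian_alternating]
      intro hs
      have hs : Real.sin (y inputIndex) = 0 := by linarith
      have := Real.sin_sq_add_cos_sq (y inputIndex)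
      simp [hs, hc] at this
    have hx := (isCritical_alternating_iff _ _).2 h0
    exact ⟨alternatingWeights (-1), alternatingWeights_mem_fullRank (by norm_num), 0,
      ⟨x, Set.mem_univ _, Z_one_alternating_eq_zero h0, hnd x hx⟩, hC _ _,
      ⟨x, Set.mem_univ _, hx⟩, fun q _ hq => hnd q hq⟩

end

/-! ### Assembly of the four cases -/

theorem mainTheorem3 (k : ℕ) (hk : 2 ≤ k) :
    (∀ (A : Architecture) (σ : A.Activation), A.Admissible k σ →
      ∀ X : Set A.Input, IsOpen X →
      ∀ j : ℕ, A.FirstBottleneckAt j →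
      -- (a) non-augmented first bottleneck, `Z_j` without zeros
      (A.DecreasesTo j →
        (∀ (W : A.Weights) (b : A.Biases), W ∈ A.fullRank →
          (∀ x ∈ X, Architecture.Z σ W b x j ≠ 0) →
          ClassC1 k X (Architecture.network σ W b)) ∧
        (∀ᵐ θ : A.Params,
          (∀ x ∈ X, Architecture.Z σ θ.weights θ.biases x j ≠ 0) →
          ClassC1 k X (Architecture.network σ θ.weights θ.biases))) ∧
      -- (b) non-augmented first bottleneck, `Z_j` with a zero
      (A.DecreasesTo j →
        ∀ (W : A.Weights) (b : A.Biases),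
          (∃ x ∈ X, Architecture.Z σ W b x j = 0) →
          (∀ x ∈ X, Architecture.Z σ W b x j = 0 →
            IsDegenerateCritical (Architecture.network σ W b) x) ∧
          ClassC3 k X (Architecture.network σ W b)) ∧
      -- (c) augmented first bottleneck, `Z_i` without zeros
      (∀ i < j, A.IncreasesTo i →
        (∀ᵐ θ : A.Params, θ.weights ∈ A.fullRank →
          (∀ x ∈ X, Architecture.Z σ θ.weights θ.biases x i ≠ 0) →
          ClassC1 k X (Architecture.network σ θ.weights θ.biases) ∨
            ClassC2 k X (Architecture.network σ θ.weights θ.biases)) ∧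
        (∀ᵐ θ : A.Params,
          (∀ x ∈ X, Architecture.Z σ θ.weights θ.biases x i ≠ 0) →
          ClassC1 k X (Architecture.network σ θ.weights θ.biases) ∨
            ClassC2 k X (Architecture.network σ θ.weights θ.biases))) ∧
      -- (d) augmented first bottleneck, `Z_i` with a zero
      (∀ i < j, A.IncreasesTo i →
        ∀ (W : A.Weights) (b : A.Biases),
          (∃ x ∈ X, Architecture.Z σ W b x i = 0) →
          (∀ x ∈ X, Architecture.Z σ W b x i = 0 →
            IsCritical (Architecture.network σ W b) x) ∧
          (ClassC2 k X (Architecture.network σ W b) ∨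
            ClassC3 k X (Architecture.network σ W b)))) ∧
    -- in (d), the zeros of `Z_i` can be degenerate and can be non-degenerate critical points
    (∃ (A : Architecture) (σ : A.Activation) (X : Set A.Input) (i j : ℕ),
      (∀ m ≤ 2 * A.L, 0 < A.d m) ∧ A.Admissible k σ ∧ IsOpen X ∧
      A.FirstBottleneckAt j ∧ i < j ∧ A.IncreasesTo i ∧
      (∃ W ∈ A.fullRank, ∃ b : A.Biases,
        (∃ x ∈ X, Architecture.Z σ W b x i = 0 ∧
          IsDegenerateCritical (Architecture.network σ W b) x) ∧
        ClassC3 k X (Architecture.network σ W b)) ∧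
      (∃ W ∈ A.fullRank, ∃ b : A.Biases,
        (∃ x ∈ X, Architecture.Z σ W b x i = 0 ∧
          IsNondegenerateCritical (Architecture.network σ W b) x) ∧
        ClassC2 k X (Architecture.network σ W b))) := by
  refine ⟨fun A σ hσ X hX j hj => ?_, exists_degenerate_and_nondegenerate k⟩
  have hC : ∀ W b, ContDiffOn ℝ k (Architecture.network σ W b) X := fun W b =>
    (Architecture.contDiff_network hσ W b).contDiffOn
  have hjL := Architecture.lt_of_firstBottleneckAt hj
  have hc1 : A.DecreasesTo j → ∀ (W : A.Weights) (b : A.Biases), W ∈ A.fullRank →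
      (∀ x ∈ X, Architecture.Z σ W b x j ≠ 0) → ClassC1 k X (Architecture.network σ W b) :=
    fun hd W b hW hZ => ⟨hC W b, fun x hx hc =>
      Architecture.Z_zero_ne_zero hσ W b x hW hjL hd.antitone (hZ x hx)
        ((Architecture.isCritical_network_iff hσ hk W b x).1 hc)⟩
  refine ⟨fun hd => ⟨hc1 hd, ?_⟩, fun hd W b hex => ?_, fun i hij hi => ?_,
    fun i hij hi W b hex => ?_⟩
  · filter_upwards [Architecture.ae_weights_mem_fullRank] with θ hθ
    exact hc1 hd _ _ hθ
  · have hdeg : ∀ x ∈ X, Architecture.Z σ W b x j = 0 →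
        IsDegenerateCritical (Architecture.network σ W b) x := fun x _ hZ =>
      Architecture.isDegenerateCritical_of_Z_eq_zero hσ hk W b x hjL.le hd.lt_input hZ
    obtain ⟨x, hx, hZ⟩ := hex
    exact ⟨hdeg, hC W b, x, hx, hdeg x hx hZ⟩
  · obtain ⟨m, rfl⟩ : ∃ m, i = m + 1 := Nat.exists_eq_add_one.2 hi.1
    have hae : ∀ᵐ θ : A.Params,
        (∀ x ∈ X, Architecture.Z σ θ.weights θ.biases x (m + 1) ≠ 0) →
        ClassC1 k X (Architecture.network σ θ.weights θ.biases) ∨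
          ClassC2 k X (Architecture.network σ θ.weights θ.biases) := by
      -- With `i = m + 1`, the perturbed matrix leads from layer `m` into layer `i`, so the widths
      -- have to increase only up to `d_m`.
      filter_upwards [Architecture.ae_isNondegenerateCritical hσ hk (hij.trans hjL)
        fun l hl => hi.2.1 l (Nat.succ_lt_succ hl)] with θ hθ hZ
      by_cases hex : ∃ p ∈ X, IsCritical (Architecture.network σ θ.weights θ.biases) p
      · exact Or.inr ⟨hC _ _, hex, fun q hq => hθ q (hZ q hq)⟩
      · exact Or.inl ⟨hC _ _, fun x hx hc => hex ⟨x, hx, hc⟩⟩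
    exact ⟨hae.mono fun θ h _ => h, hae⟩
  · have hcrit : ∀ x ∈ X, Architecture.Z σ W b x i = 0 →
        IsCritical (Architecture.network σ W b) x := fun x _ hZ =>
      (Architecture.isCritical_network_iff hσ hk W b x).2
        (Architecture.Z_zero_eq_zero W b x (hij.trans hjL).le hZ)
    obtain ⟨x, hx, hZ⟩ := hex
    refine ⟨hcrit, ?_⟩
    by_cases hdeg : ∃ p ∈ X, IsDegenerateCritical (Architecture.network σ W b) p
    · exact Or.inr ⟨hC W b, hdeg⟩
    · exact Or.inl ⟨hC W b, ⟨x, hx, hcrit x hx hZ⟩, fun q hq hc =>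
        ⟨hc, fun h0 => hdeg ⟨q, hq, hc, h0⟩⟩⟩
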